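/- Let $q_1=(0,0)$, $q_2=(1,0)$, $q_3=(1/2,\sqrt3/2)$, $l_n(x)=\tfrac12(x-q_n)+q_n$, and $l_w=l_{w_1}\circ\dots\circ l_{w_m}$ for a word $w\in\{1,2,3\}^m$. Put $V_0=\{q_1,q_2,q_3\}$, $V_m=\bigcup_{|w|=m}l_w(V_0)$, and let $\mathcal K=\overline{\bigcup_m V_m}$ be the Sierpinski gasket. A continuous function $h:\mathcal K\to\mathbb R$ is called harmonic if, for every $m\ge 1$, it minimizes $$\mathcal E_m(g)=\Bigl(\frac53\Bigr)^m\sum_{|w|=m}\ \sum_{1\le i<j\le 3}\bigl(g(l_w(q_i))-g(l_w(q_j))\bigr)^2$$ among all functions $g$ on $V_m$ with $g=h$ on $V_0$. Let $J\subset\mathbb R$ be compact and let $u:V_1\to\mathbb R$ be data with $u(V_0)\subset J$. For $n=1,2,3$ let $h_n:\mathcal K\to\mathbb R$ be a nonconstant harmonic function and let $s_n:J\to J$ satisfy $|s_n(x)-s_n(y)|<|x-y|$ for all $x\ne y$ in $J$. Assume that $F_n(x,y)=h_n(x)+s_n(y)$ maps $\mathcal K\times J$ into $J$ and that $F_n(q_k,u(q_k))=u(l_n(q_k))$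 for all $n,k\in\{1,2,3\}$. Let $W_n(x,y)=(l_n(x),F_n(x,y))$ on $\mathcal K\times J$, and let $f^*:\mathcal K\to J$ be the nonlinear fractal interpolation function of this system, that is, the continuous function with $f^*=u$ on $V_1$ whose graph $G=\{(x,f^*(x)):x\in\mathcal K\}$ satisfies $G=\bigcup_{n=1}^3W_n(G)$ (equivalently, $f^*(l_n(x))=h_n(x)+s_n(f^*(x))$ for all $n$ and all $x\in\mathcal K$). Suppose that the interpolation points $(t,u(t))$, $t\in V_1$, are not coplanar in $\mathbb R^3$, and let $$\mu=\sum_{n=1}^3L(s_n),\qquad L(s_n)=\sup_{x,y\in J,\ x\neq y}\frac{|s_n(x)-s_n(y)|}{|x-y|}.$$ For bounded $F\subset\mathbb R^3$ let $N_\delta(F)$ be the smallest number of axis-parallel cubes of side length $\delta$ that cover $F$, and let $\overline{\dim}_B(F)=\limsup_{\delta\to0^+}\frac{\log N_\delta(F)}{-\log\delta}$ be the upper box-counting dimension. Then: (i) if $\mu>9/5$, then $\overline{\dim}_B(G)\le 1+\dfrac{\log\mu}{\log 2}$; (ii) if $\mu\le 9/5$, then $\overline{\dim}_B(G)\le\dfrac{\log(18/5)}{\log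 2}$. In particular the same bounds hold for the box-counting dimension of $G$ whenever it exists. -/

import Mathlib

open Filter Topology Set

noncomputable section

/-! ## The Sierpinski gasket -/

/-- The plane `ℝ²`. Only its coordinates and its topology are used, never a particular norm. -/
abbrev Plane : Type := Fin 2 → ℝ

/-- The vertices `q₁ = (0, 0)`, `q₂ = (1, 0)`, `q₃ = (1/2, √3/2)` of an equilateral triangle. -/
def gasketVertex : Fin 3 → Plane :=
  ![![0, 0], ![1, 0], ![1 / 2, √3 / 2]]

/-- The similarity `l_n(x) = (x - q_n) / 2 + q_n`. -/
def gasketMap (n : Fin 3) (x : Plane) : Plane :=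
  (1 / 2 : ℝ) • (x - gasketVertex n) + gasketVertex n

/-- `l_w = l_{w₁} ∘ ⋯ ∘ l_{w_m}` for a word `w` of length `m` (the identity if `m = 0`). -/
def gasketWordMap : (m : ℕ) → (Fin m → Fin 3) → Plane → Plane
  | 0, _ => id
  | m + 1, w => gasketMap (w 0) ∘ gasketWordMap m (fun i => w i.succ)

/-- `V_m`, the union of the sets `l_w(V_0)` over the words `w` of length `m`,
with `V_0 = {q₁, q₂, q₃}`. -/
def gasketVertices (m : ℕ) : Set Plane :=
  ⋃ w : Fin m → Fin 3, gasketWordMap m w '' range gasketVertex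

/-- The Sierpinski gasket `K`, the closure of `V_* = ⋃ₘ V_m`. -/
def sierpinskiGasket : Set Plane :=
  closure (⋃ m, gasketVertices m)

/-! ## Energy and harmonic functions on the gasket -/

/-- The energy `E_0(f)` of (the restriction of `f` to) the three vertices. -/
def vertexEnergy (f : Plane → ℝ) : ℝ :=
  (f (gasketVertex 0) - f (gasketVertex 1)) ^ 2
    + (f (gasketVertex 1) - f (gasketVertex 2)) ^ 2
    + (f (gasketVertex 2) - f (gasketVertex 0)) ^ 2

/-- The graph energy `E_m(f) = (5/3)^m ∑_w E_0(f ∘ l_w)`, the sum over the words of length `m`.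
It only depends on the restriction of `f` to `V_m`. -/
def graphEnergy (m : ℕ) (f : Plane → ℝ) : ℝ :=
  (5 / 3 : ℝ) ^ m * ∑ w : Fin m → Fin 3, vertexEnergy (f ∘ gasketWordMap m w)

/-- `h` is harmonic on the gasket: it is continuous there, and at every level `m ≥ 1` it minimizes
`E_m` among the functions with the same values on `V_0`. -/
def IsHarmonicOnGasket (h : Plane → ℝ) : Prop :=
  ContinuousOn h sierpinskiGasket ∧
    ∀ m : ℕ, 1 ≤ m → ∀ v : Plane → ℝ,
      (∀ i, v (gasketVertex i) = h (gasketVertex i)) → graphEnergy m h ≤ graphEnergy m v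

/-! ## Edelstein contractions and the Lipschitz constant -/

/-- `s` restricts to an Edelstein contraction `J → J`. -/
def IsEdelsteinOn (J : Set ℝ) (s : ℝ → ℝ) : Prop :=
  MapsTo s J J ∧ ∀ x ∈ J, ∀ y ∈ J, x ≠ y → dist (s x) (s y) < dist x y

/-- The upper Lipschitz constant `L(s)` of `s : J → J`, the supremum of the difference quotients.
For an Edelstein contraction these are bounded by `1`, so that the supremum is a true one. -/
def upperLipschitz (J : Set ℝ) (s : ℝ → ℝ) : ℝ :=
  sSup {r : ℝ | ∃ x ∈ J, ∃ y ∈ J, x ≠ y ∧ r = dist (s x) (s y) / dist x y}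

/-! ## The nonlinear iterated function system and its interpolation function -/

/-- The map `W_n(x, y) = (l_n(x), h_n(x) + s_n(y))`. -/
def ifsMap (h : Fin 3 → Plane → ℝ) (s : Fin 3 → ℝ → ℝ) (n : Fin 3) (z : Plane × ℝ) : Plane × ℝ :=
  (gasketMap n z.1, h n z.1 + s n z.2)

/-- The standing requirements on a nonlinear iterated function system on `K × J` for the data
`u : V_1 → ℝ` (only the values of `u` on `V_1`, of `h n` on `K` and of `s n` on `J` matter). -/
structure IsNonlinearIFS (J : Set ℝ) (u : Plane → ℝ) (h : Fin 3 → Plane → ℝ)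
    (s : Fin 3 → ℝ → ℝ) : Prop where
  isCompact : IsCompact J
  data_mem : ∀ k, u (gasketVertex k) ∈ J
  harmonic : ∀ n, IsHarmonicOnGasket (h n)
  nonconstant : ∀ n, ∃ x ∈ sierpinskiGasket, ∃ y ∈ sierpinskiGasket, h n x ≠ h n y
  edelstein : ∀ n, IsEdelsteinOn J (s n)
  mapsTo : ∀ n, ∀ x ∈ sierpinskiGasket, ∀ y ∈ J, h n x + s n y ∈ J
  join_up : ∀ n k, h n (gasketVertex k) + s n (u (gasketVertex k))
    = u (gasketMap n (gasketVertex k))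

/-- `f` is the fractal interpolation function of the system: a continuous function `K → J` that
interpolates `u` on `V_1` and whose graph is an invariant set of the system. -/
structure IsFIF (J : Set ℝ) (u : Plane → ℝ) (h : Fin 3 → Plane → ℝ) (s : Fin 3 → ℝ → ℝ)
    (f : Plane → ℝ) : Prop where
  continuousOn : ContinuousOn f sierpinskiGasket
  mapsTo : MapsTo f sierpinskiGasket J
  interpolates : ∀ t ∈ gasketVertices 1, f t = u t
  invariant : sierpinskiGasket.graphOn f = ⋃ n, ifsMap h s n '' sierpinskiGasket.graphOn f

/-- The identification `ℝ² × ℝ → ℝ³`. -/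
def toSpace (z : Plane × ℝ) : Fin 3 → ℝ :=
  ![z.1 0, z.1 1, z.2]

/-! ## Box-counting dimension -/

/-- The smallest number of cubes `∏ᵢ [aᵢ, aᵢ + δ]` of side length `δ` that cover `F`
(`⊤` if finitely many do not suffice). -/
def cubeCount {d : ℕ} (δ : ℝ) (F : Set (Fin d → ℝ)) : ℕ∞ :=
  ⨅ (A : Finset (Fin d → ℝ)) (_ : F ⊆ ⋃ a ∈ A, Icc a (fun i => a i + δ)), (A.card : ℕ∞)

/-- The upper box-counting dimension of `F ⊆ ℝᵈ`, the upper limit of `log N_δ(F) / (-log δ)` as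
`δ → 0+`. -/
def upperBoxDim {d : ℕ} (F : Set (Fin d → ℝ)) : EReal :=
  limsup (fun δ : ℝ => ENNReal.log (cubeCount δ F : ENNReal) / ((-Real.log δ : ℝ) : EReal)) (𝓝[>] 0)

end

open Filter Topology Set

/-! ## Barycentric coordinates -/

/-! The box count of the graph is controlled by `R_m`, the sum over words `w` of length `m` of
bounds for the oscillation of `f` on the cell `l_w(K)`. Testing the minimality of a harmonic
function against indicators of midpoints gives the 2/5-2/5-1/5 rule, so its oscillation decays like
`(3/5)^m` (`IsHarmonicOnGasket.exists_oscillation_le`); over `3^m` cells this adds up to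
`O((9/5)^m)`. The functional equation of `f` then yields `R_(m+1) ≤ C (9/5)^m + μ R_m`, hence `R_m =
O(lam^m)` whenever `lam > 9/5` and `lam ≥ μ` (`IsFIF.exists_oscillation_sum_le`).

At scale `2^(-m)` the graph over a cell needs about `2^m` times its oscillation, plus one, cubes
(`cubeCount_graph_le`). The total is `O((2 lam)^m + 3^m) = O((2 lam)^m)`, giving dimension at most
`1 + log lam / log 2`. Case (i) takes `lam = μ`; case (ii) lets `lam` decrease to `9/5`. -/

/-- The barycentric coordinates with respect to the vertices `q₁, q₂, q₃`. -/
noncomputable def baryCoord (x : Plane) : Fin 3 → ℝ :=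
  ![1 - x 0 - x 1 / √3, x 0 - x 1 / √3, 2 * (x 1 / √3)]

/-- The full triangle with vertices `q₁, q₂, q₃`. -/
def fullTriangle : Set Plane := {x | ∀ k, 0 ≤ baryCoord x k}

theorem baryCoord_gasketVertex (n k : Fin 3) :
    baryCoord (gasketVertex n) k = if k = n then 1 else 0 := by
  have h3 : (√3 : ℝ) ≠ 0 := by positivity
  fin_cases n <;> fin_cases k <;> simp [baryCoord, gasketVertex] <;> field_simp <;> norm_num

theorem baryCoord_gasketMap (n k : Fin 3) (x : Plane) :
    baryCoord (gasketMap n x) k = (baryCoord x k + if k = n then 1 else 0) / 2 := by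
  rw [← baryCoord_gasketVertex]
  fin_cases k <;> simp [baryCoord, gasketMap] <;> ring

theorem baryCoord_injective : Function.Injective baryCoord := by
  intro x y hxy
  have h3 : (√3 : ℝ) ≠ 0 := by positivity
  have h1 := congrFun hxy 1
  have h2 := congrFun hxy 2
  simp only [baryCoord, Matrix.cons_val_one, Matrix.cons_val_zero, Matrix.cons_val] at h1 h2
  have e1 : x 1 / √3 = y 1 / √3 := by linarith
  have e2 : x 1 = y 1 := by field_simp at e1; exact e1
  ext i
  fin_cases i
  · simp only [Fin.zero_eta]; linarith
  · exact e2

theorem continuous_baryCoord (k : Fin 3) : Continuous fun x => baryCoord x k := by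
  fin_cases k <;> simp [baryCoord] <;> fun_prop

theorem isClosed_fullTriangle : IsClosed fullTriangle := by
  simp only [fullTriangle, ofPred_forall]
  exact isClosed_iInter fun k => isClosed_le continuous_const (continuous_baryCoord k)

theorem gasketVertex_mem_fullTriangle (n : Fin 3) : gasketVertex n ∈ fullTriangle := by
  intro k
  rw [baryCoord_gasketVertex]
  split_ifs <;> norm_num

theorem gasketMap_mem_fullTriangle (n : Fin 3) {x : Plane} (hx : x ∈ fullTriangle) :
    gasketMap n x ∈ fullTriangle := by
  intro k
  rw [baryCoord_gasketMap]
  have := hx k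
  split_ifs <;> linarith

theorem gasketMap_injective (n : Fin 3) : Function.Injective (gasketMap n) := by
  intro x y hxy
  apply baryCoord_injective
  ext k
  have := congrArg (fun z => baryCoord z k) hxy
  simp only [baryCoord_gasketMap] at this
  linarith

theorem continuous_gasketMap (n : Fin 3) : Continuous (gasketMap n) := by
  unfold gasketMap; fun_prop

theorem gasketMap_gasketVertex_self (n : Fin 3) : gasketMap n (gasketVertex n) = gasketVertex n := by
  simp [gasketMap]

theorem gasketMap_gasketVertex_eq_iff {i j : Fin 3} (hij : i ≠ j) (n k : Fin 3) :
    gasketMap n (gasketVertex k) = gasketMap i (gasketVertex j) ↔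
      (n = i ∧ k = j) ∨ (n = j ∧ k = i) := by
  constructor
  · intro h
    have h' : ∀ a, (baryCoord (gasketMap n (gasketVertex k)) a)
        = baryCoord (gasketMap i (gasketVertex j)) a := fun a => by rw [h]
    simp only [baryCoord_gasketMap, baryCoord_gasketVertex] at h'
    -- Doubled coordinates are counts of indices, so the claim is equality of the multisets `{n, k}`
    -- and `{i, j}`, a finite check.
    have hN : ∀ a : Fin 3, ((if a = k then 1 else 0) + (if a = n then 1 else 0) : ℕ)
        = (if a = j then 1 else 0) + (if a = i then 1 else 0) := by
      intro a
      have := h' a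
      split_ifs at this ⊢ <;> first | rfl | norm_num at this
    clear h h'
    revert i j n k
    decide
  · rintro (⟨rfl, rfl⟩ | ⟨rfl, rfl⟩)
    · rfl
    · simp only [gasketMap]; module

/-- Distinct first-level cells meet only in their common vertex. -/
theorem gasketMap_ne_gasketMap {a n : Fin 3} (han : n ≠ a) {y z : Plane}
    (hy1 : ∀ k, baryCoord y k < 1) (hz : z ∈ fullTriangle) : gasketMap n z ≠ gasketMap a y := by
  intro h
  have h' : ∀ k, (baryCoord (gasketMap n z) k) = baryCoord (gasketMap a y) k := fun a => by rw [h]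
  simp only [baryCoord_gasketMap] at h'
  -- The `n`-th coordinate is at least `1/2` on the left and below `1/2` on the right.
  have hn := h' n
  simp only [han, if_true, if_false] at hn
  have := hz n
  have := hy1 n
  linarith

/-! ## Words -/

theorem gasketWordMap_cons {m : ℕ} (n : Fin 3) (w : Fin m → Fin 3) :
    gasketWordMap (m + 1) (Fin.cons n w) = gasketMap n ∘ gasketWordMap m w := by
  simp [gasketWordMap]

theorem sum_words_succ {m : ℕ} (F : (Fin (m + 1) → Fin 3) → ℝ) :
    ∑ w, F w = ∑ n, ∑ w, F (Fin.cons n w) := by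
  rw [← Fintype.sum_prod_type' (f := fun n (w : Fin m → Fin 3) => F (Fin.cons n w))]
  exact (Fintype.sum_equiv (Fin.consEquiv fun _ : Fin (m + 1) => Fin 3) _ _ fun _ => rfl).symm

theorem gasketWordMap_mem_fullTriangle {m : ℕ} (w : Fin m → Fin 3) {x : Plane}
    (hx : x ∈ fullTriangle) : gasketWordMap m w x ∈ fullTriangle := by
  induction m with
  | zero => exact hx
  | succ m ih => exact gasketMap_mem_fullTriangle _ (ih _)

/-- Having all coordinates below `1` keeps a point off `V_0`; this survives passage to smaller
cells. -/
theorem baryCoord_gasketWordMap_lt_one {m : ℕ} (w : Fin m → Fin 3) {x : Plane}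
    (hx : ∀ k, baryCoord x k < 1) (k : Fin 3) : baryCoord (gasketWordMap m w x) k < 1 := by
  induction m with
  | zero => exact hx k
  | succ m ih =>
    have := ih fun i => w i.succ
    simp only [gasketWordMap, Function.comp_apply, baryCoord_gasketMap]
    split_ifs <;> linarith

theorem continuous_gasketWordMap {m : ℕ} (w : Fin m → Fin 3) : Continuous (gasketWordMap m w) := by
  induction m with
  | zero => exact continuous_id
  | succ m ih => exact (continuous_gasketMap _).comp (ih _)

theorem gasketWordMap_apply {m : ℕ} (w : Fin m → Fin 3) (x : Plane) :
    gasketWordMap m w x = gasketWordMap m w 0 + (1 / 2 : ℝ) ^ m • x := by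
  induction m with
  | zero => simp [gasketWordMap]
  | succ m ih =>
    simp only [gasketWordMap, Function.comp_apply]
    rw [ih, gasketMap, gasketMap, pow_succ]
    module

theorem mem_iUnion_gasketVertices {x : Plane} :
    x ∈ ⋃ m, gasketVertices m ↔
      ∃ (m : ℕ) (w : Fin m → Fin 3) (k : Fin 3), gasketWordMap m w (gasketVertex k) = x := by
  simp [gasketVertices]

theorem gasketVertex_mem_sierpinskiGasket (n : Fin 3) : gasketVertex n ∈ sierpinskiGasket :=
  subset_closure (mem_iUnion_gasketVertices.2 ⟨0, Fin.elim0, n, rfl⟩)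

theorem gasketMap_mem_sierpinskiGasket (n : Fin 3) {x : Plane} (hx : x ∈ sierpinskiGasket) :
    gasketMap n x ∈ sierpinskiGasket := by
  refine map_mem_closure (continuous_gasketMap n) hx fun y hy => ?_
  obtain ⟨m, w, k, rfl⟩ := mem_iUnion_gasketVertices.1 hy
  exact mem_iUnion_gasketVertices.2 ⟨m + 1, Fin.cons n w, k, by rw [gasketWordMap_cons]; rfl⟩

theorem gasketWordMap_mem_sierpinskiGasket {m : ℕ} (w : Fin m → Fin 3) {x : Plane}
    (hx : x ∈ sierpinskiGasket) : gasketWordMap m w x ∈ sierpinskiGasket := by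
  induction m with
  | zero => exact hx
  | succ m ih => exact gasketMap_mem_sierpinskiGasket _ (ih _)

theorem sierpinskiGasket_subset_fullTriangle : sierpinskiGasket ⊆ fullTriangle := by
  refine closure_minimal (fun x hx => ?_) isClosed_fullTriangle
  obtain ⟨m, w, k, rfl⟩ := mem_iUnion_gasketVertices.1 hx
  exact gasketWordMap_mem_fullTriangle w (gasketVertex_mem_fullTriangle k)

theorem fullTriangle_subset_Icc : fullTriangle ⊆ Icc 0 1 := by
  intro x hx
  have h0 := hx 0
  have h1 := hx 1
  have h2 := hx 2
  simp only [baryCoord, Matrix.cons_val_one, Matrix.cons_val_zero, Matrix.cons_val] at h0 h1 h2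
  have h3 : (0 : ℝ) < √3 := by positivity
  have h4 : (√3 : ℝ) ≤ 2 := by rw [Real.sqrt_le_left (by norm_num)]; norm_num
  have h5 : x 1 = x 1 / √3 * √3 := by field_simp
  have h6 : 0 ≤ x 1 / √3 := by linarith
  have h7 : x 1 / √3 * √3 ≤ (1 / 2) * 2 :=
    mul_le_mul (by linarith) h4 h3.le (by norm_num)
  have h8 : 0 ≤ x 1 / √3 * √3 := by positivity
  rw [← h5] at h7 h8
  constructor <;> intro i <;> fin_cases i <;>
    simp only [Fin.zero_eta, Fin.mk_one, Pi.zero_apply, Pi.one_apply] <;> linarith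

/-! ## The energy form -/

/-- The bilinear form polarizing `vertexEnergy`. -/
noncomputable def vertexForm (f g : Plane → ℝ) : ℝ :=
  (f (gasketVertex 0) - f (gasketVertex 1)) * (g (gasketVertex 0) - g (gasketVertex 1))
    + (f (gasketVertex 1) - f (gasketVertex 2)) * (g (gasketVertex 1) - g (gasketVertex 2))
    + (f (gasketVertex 2) - f (gasketVertex 0)) * (g (gasketVertex 2) - g (gasketVertex 0))

/-- The bilinear form polarizing `graphEnergy`, without its scaling factor. -/
noncomputable def wordForm (m : ℕ) (f g : Plane → ℝ) : ℝ :=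
  ∑ w : Fin m → Fin 3, vertexForm (f ∘ gasketWordMap m w) (g ∘ gasketWordMap m w)

theorem wordForm_succ (m : ℕ) (f g : Plane → ℝ) :
    wordForm (m + 1) f g = ∑ n, wordForm m (f ∘ gasketMap n) (g ∘ gasketMap n) := by
  simp only [wordForm, sum_words_succ, gasketWordMap_cons, Function.comp_assoc]

theorem wordForm_zero (f g : Plane → ℝ) : wordForm 0 f g = vertexForm f g := by
  simp [wordForm, gasketWordMap]

theorem graphEnergy_add_mul (m : ℕ) (f g : Plane → ℝ) (t : ℝ) :
    graphEnergy m (fun x => f x + t * g x) = graphEnergy m f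
      + (5 / 3 : ℝ) ^ m * (wordForm m g g * (t * t) + 2 * wordForm m f g * t) := by
  simp only [graphEnergy, wordForm, ← mul_add, Finset.mul_sum, Finset.sum_mul,
    ← Finset.sum_add_distrib]
  refine Finset.sum_congr rfl fun w _ => ?_
  simp only [vertexEnergy, vertexForm, Function.comp_apply]
  ring

theorem wordForm_eq_zero_of_eqOn (m : ℕ) (f : Plane → ℝ) {g : Plane → ℝ}
    (hg : ∀ x ∈ fullTriangle, g x = 0) : wordForm m f g = 0 := by
  refine Finset.sum_eq_zero fun w _ => ?_
  have h : ∀ k, (g ∘ gasketWordMap m w) (gasketVertex k) = 0 := fun k =>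
    hg _ (gasketWordMap_mem_fullTriangle w (gasketVertex_mem_fullTriangle k))
  simp only [vertexForm, h, sub_self, mul_zero, add_zero]

/-- Minimizers of the energy are orthogonal to functions vanishing on `V_0`. -/
theorem IsHarmonicOnGasket.wordForm_eq_zero {h : Plane → ℝ} (hh : IsHarmonicOnGasket h) {m : ℕ}
    (hm : 1 ≤ m) {g : Plane → ℝ} (hg : ∀ i, g (gasketVertex i) = 0) : wordForm m h g = 0 := by
  -- A nonnegative quadratic in `t` with zero constant term has discriminant `(2 * wordForm m h g)^2
  -- ≤ 0`.
  have key : ∀ t : ℝ, 0 ≤ wordForm m g g * (t * t) + 2 * wordForm m h g * t + 0 := by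
    intro t
    have h1 := hh.2 m hm (fun x => h x + t * g x) fun i => by simp [hg]
    rw [graphEnergy_add_mul] at h1
    have h2 : 0 < (5 / 3 : ℝ) ^ m := by positivity
    rw [add_zero]
    exact (mul_nonneg_iff_of_pos_left h2).1 (by linarith)
  have := discrim_le_zero key
  simp only [discrim] at this
  nlinarith [sq_nonneg (wordForm m h g)]

/-- The indicator function of a point, as a real function. -/
noncomputable def pointIndicator (p : Plane) : Plane → ℝ := indicator {p} fun _ => 1

theorem pointIndicator_comp_gasketMap (n : Fin 3) (p : Plane) :
    pointIndicator (gasketMap n p) ∘ gasketMap n = pointIndicator p := by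
  ext x
  simp only [pointIndicator, indicator, Function.comp_apply, mem_singleton_iff,
    (gasketMap_injective n).eq_iff]

/-- A non-corner point of a cell lies in no other cell of the same level, so only the terms inside
the cell of `w` survive. -/
theorem wordForm_pointIndicator {m : ℕ} (w : Fin m → Fin 3) (f : Plane → ℝ) {y : Plane}
    (hy1 : ∀ k, baryCoord y k < 1) :
    wordForm (m + 1) f (pointIndicator (gasketWordMap m w y))
      = wordForm 1 (f ∘ gasketWordMap m w) (pointIndicator y) := by
  induction m generalizing f with
  | zero => rfl
  | succ m ih =>
    rw [wordForm_succ, Finset.sum_eq_single (w 0)]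
    · simp only [gasketWordMap, Function.comp_apply]
      rw [pointIndicator_comp_gasketMap, ih]
      rfl
    · intro n _ hn
      refine wordForm_eq_zero_of_eqOn _ _ fun x hx => ?_
      have := gasketMap_ne_gasketMap hn
        (baryCoord_gasketWordMap_lt_one (fun i => w i.succ) hy1) hx
      rw [Function.comp_apply, pointIndicator, indicator_of_notMem]
      exact fun hx => this (mem_singleton_iff.1 hx)
    · simp

theorem baryCoord_midpoint_lt_one {i j : Fin 3} (hij : i ≠ j) (k : Fin 3) :
    baryCoord (gasketMap i (gasketVertex j)) k < 1 := by
  rw [baryCoord_gasketMap, baryCoord_gasketVertex]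
  by_cases h : k = i
  · simp [h, hij]; norm_num
  · simp only [h, if_false]; split_ifs <;> norm_num

/-! ## Harmonic functions -/

/-- The `2/5`-`2/5`-`1/5` rule on the first-level subdivision. -/
def SatisfiesExtensionRule (g : Plane → ℝ) : Prop :=
  ∀ i j k : Fin 3, i ≠ j → j ≠ k → k ≠ i → g (gasketMap i (gasketVertex j))
    = (2 * g (gasketVertex i) + 2 * g (gasketVertex j) + g (gasketVertex k)) / 5

/-- Each midpoint value is the mean of its four neighbours: two vertices and the two other
midpoints. Solving this 3×3 linear system gives the rule. -/
theorem satisfiesExtensionRule_of_wordForm {g : Plane → ℝ}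
    (hg : ∀ i j : Fin 3, i ≠ j → wordForm 1 g (pointIndicator (gasketMap i (gasketVertex j))) = 0) :
    SatisfiesExtensionRule g := by
  have e : ∀ i j : Fin 3, i ≠ j → ∀ n k, pointIndicator (gasketMap i (gasketVertex j))
      (gasketMap n (gasketVertex k)) = if (n = i ∧ k = j) ∨ (n = j ∧ k = i) then 1 else 0 := by
    intro i j hij n k
    simp only [pointIndicator, indicator, mem_singleton_iff, gasketMap_gasketVertex_eq_iff hij]
  have c : ∀ i j : Fin 3, i ≠ j →
      gasketMap j (gasketVertex i) = gasketMap i (gasketVertex j) := fun i j hij =>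
    (gasketMap_gasketVertex_eq_iff hij j i).2 (Or.inr ⟨rfl, rfl⟩)
  have h01 := hg 0 1 (by decide)
  have h12 := hg 1 2 (by decide)
  have h20 := hg 2 0 (by decide)
  simp only [wordForm_succ, wordForm_zero, vertexForm, Fin.sum_univ_three, Function.comp_apply,
    e 0 1 (by decide), e 1 2 (by decide), e 2 0 (by decide), gasketMap_gasketVertex_self,
    c 0 1 (by decide), c 1 2 (by decide), c 2 0 (by decide)] at h01 h12 h20
  simp only [Fin.isValue, Fin.reduceEq, and_true, and_false, and_self, or_self,
    or_false, false_or, if_true, if_false] at h01 h12 h20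
  intro i j k hij hjk hki
  fin_cases i <;> fin_cases j <;> fin_cases k <;>
    simp only [Fin.zero_eta, Fin.mk_one, Fin.reduceFinMk, ne_eq, not_true_eq_false] at hij hjk hki ⊢ <;>
    try simp only [c 0 1 (by decide), c 1 2 (by decide), c 2 0 (by decide)]
  all_goals linarith

/-- A function obeying the extension rule in every cell. -/
def IsExtensionHarmonic (g : Plane → ℝ) : Prop :=
  ∀ (m : ℕ) (w : Fin m → Fin 3), SatisfiesExtensionRule (g ∘ gasketWordMap m w)

theorem IsHarmonicOnGasket.isExtensionHarmonic {h : Plane → ℝ} (hh : IsHarmonicOnGasket h) :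
    IsExtensionHarmonic h := by
  intro m w
  refine satisfiesExtensionRule_of_wordForm fun i j hij => ?_
  have hb := baryCoord_midpoint_lt_one hij
  rw [← wordForm_pointIndicator w h hb]
  refine hh.wordForm_eq_zero (by omega) fun n => ?_
  have h1 := baryCoord_gasketWordMap_lt_one w hb n
  rw [pointIndicator, indicator_of_notMem]
  intro hn
  rw [← mem_singleton_iff.1 hn, baryCoord_gasketVertex, if_pos rfl] at h1
  exact lt_irrefl _ h1

theorem IsExtensionHarmonic.comp {g : Plane → ℝ} (hg : IsExtensionHarmonic g) (n : Fin 3) :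
    IsExtensionHarmonic (g ∘ gasketMap n) := by
  intro m w
  have := hg (m + 1) (Fin.cons n w)
  rwa [gasketWordMap_cons] at this

/-- The worst case is a corner against an adjacent midpoint: `(2 (g q_i - g q_j) + (g q_i - g q_k))
/ 5`. -/
theorem SatisfiesExtensionRule.abs_sub_le {g : Plane → ℝ} (hg : SatisfiesExtensionRule g) {D : ℝ}
    (hD : ∀ i j, |g (gasketVertex i) - g (gasketVertex j)| ≤ D) (n i j : Fin 3) :
    |g (gasketMap n (gasketVertex i)) - g (gasketMap n (gasketVertex j))| ≤ 3 / 5 * D := by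
  have d01 := abs_le.1 (hD 0 1)
  have d12 := abs_le.1 (hD 1 2)
  have d20 := abs_le.1 (hD 2 0)
  have r01 := hg 0 1 2 (by decide) (by decide) (by decide)
  have r10 := hg 1 0 2 (by decide) (by decide) (by decide)
  have r12 := hg 1 2 0 (by decide) (by decide) (by decide)
  have r21 := hg 2 1 0 (by decide) (by decide) (by decide)
  have r02 := hg 0 2 1 (by decide) (by decide) (by decide)
  have r20 := hg 2 0 1 (by decide) (by decide) (by decide)
  rw [abs_le]
  fin_cases n <;> fin_cases i <;> fin_cases j <;>
    simp only [Fin.zero_eta, Fin.mk_one, Fin.reduceFinMk, gasketMap_gasketVertex_self, r01, r10,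
      r12, r21, r02, r20] <;> constructor <;> linarith

theorem IsExtensionHarmonic.abs_sub_vertex_le {g : Plane → ℝ} (hg : IsExtensionHarmonic g) {D : ℝ}
    (hD : ∀ i j, |g (gasketVertex i) - g (gasketVertex j)| ≤ D) {m : ℕ} (w : Fin m → Fin 3)
    (i j : Fin 3) : |g (gasketWordMap m w (gasketVertex i)) - g (gasketWordMap m w (gasketVertex j))|
      ≤ (3 / 5) ^ m * D := by
  induction m generalizing g D with
  | zero => simpa [gasketWordMap] using hD i j
  | succ m ih =>
    have := ih (hg.comp (w 0)) (SatisfiesExtensionRule.abs_sub_le (hg 0 Fin.elim0) hD (w 0))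
      (fun i => w i.succ)
    rw [pow_succ, mul_assoc]
    exact this

/-- Chaining through the corner fixed by `l_(w 0)` gives the geometric series `1 + 3/5 + (3/5)^2 + ⋯
= 5/2`. -/
theorem IsExtensionHarmonic.abs_sub_le {g : Plane → ℝ} (hg : IsExtensionHarmonic g) {D : ℝ}
    (hD : ∀ i j, |g (gasketVertex i) - g (gasketVertex j)| ≤ D) {m : ℕ} (w : Fin m → Fin 3)
    (k i : Fin 3) : |g (gasketWordMap m w (gasketVertex k)) - g (gasketVertex i)| ≤ 5 / 2 * D := by
  induction m generalizing g D i with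
  | zero =>
    have h1 := hD k i
    have h2 := (abs_nonneg _).trans h1
    simp only [gasketWordMap, id]
    linarith
  | succ m ih =>
    have h1 := ih (hg.comp (w 0)) (SatisfiesExtensionRule.abs_sub_le (hg 0 Fin.elim0) hD (w 0))
      (fun i => w i.succ) (w 0)
    simp only [Function.comp_apply, gasketMap_gasketVertex_self] at h1
    simp only [gasketWordMap, Function.comp_apply]
    have h2 := _root_.abs_sub_le (g (gasketMap (w 0) (gasketWordMap m (fun i => w i.succ) (gasketVertex k))))
      (g (gasketVertex (w 0))) (g (gasketVertex i))
    linarith [hD (w 0) i]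

theorem IsExtensionHarmonic.comp_word {g : Plane → ℝ} (hg : IsExtensionHarmonic g) {m : ℕ}
    (w : Fin m → Fin 3) : IsExtensionHarmonic (g ∘ gasketWordMap m w) := by
  induction m generalizing g with
  | zero => exact hg
  | succ m ih => exact ih (hg.comp (w 0)) _

/-- A harmonic function oscillates by `O((3/5)^m)` on the cells of level `m`. -/
theorem IsHarmonicOnGasket.exists_oscillation_le {h : Plane → ℝ} (hh : IsHarmonicOnGasket h) :
    ∃ D : ℝ, 0 ≤ D ∧ ∀ (m : ℕ) (w : Fin m → Fin 3), ∀ x ∈ sierpinskiGasket,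
      ∀ y ∈ sierpinskiGasket, |h (gasketWordMap m w x) - h (gasketWordMap m w y)|
        ≤ (3 / 5) ^ m * D := by
  have hE := hh.isExtensionHarmonic
  set D := ∑ i, ∑ j, |h (gasketVertex i) - h (gasketVertex j)| with hDdef
  have hD : ∀ i j, |h (gasketVertex i) - h (gasketVertex j)| ≤ D := by
    intro i j
    refine le_trans ?_ (Finset.single_le_sum (f := fun i =>
      ∑ j, |h (gasketVertex i) - h (gasketVertex j)|) (fun i _ => ?_) (Finset.mem_univ i))
    · exact Finset.single_le_sum (f := fun j => |h (gasketVertex i) - h (gasketVertex j)|)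
        (fun _ _ => abs_nonneg _) (Finset.mem_univ j)
    · positivity
  refine ⟨5 * D, by positivity, fun m w => ?_⟩
  have key : ∀ x ∈ sierpinskiGasket,
      |h (gasketWordMap m w x) - h (gasketWordMap m w (gasketVertex 0))|
        ≤ 5 / 2 * ((3 / 5) ^ m * D) := by
    have hc : ContinuousOn (fun x => |h (gasketWordMap m w x)
        - h (gasketWordMap m w (gasketVertex 0))|) sierpinskiGasket :=
      ((hh.1.comp (continuous_gasketWordMap w).continuousOn fun x hx =>
        gasketWordMap_mem_sierpinskiGasket w hx).sub continuousOn_const).abs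
    intro x hx
    -- The bound on the dense set of vertices passes to the gasket by continuity.
    refine le_on_closure (s := ⋃ m, gasketVertices m) (fun y hy => ?_) hc continuousOn_const hx
    obtain ⟨l, v, k, rfl⟩ := mem_iUnion_gasketVertices.1 hy
    exact (hE.comp_word w).abs_sub_le (hE.abs_sub_vertex_le hD w) v k 0
  intro x hx y hy
  have := abs_sub_le (h (gasketWordMap m w x)) (h (gasketWordMap m w (gasketVertex 0)))
    (h (gasketWordMap m w y))
  have h2 := key y hy
  rw [abs_sub_comm] at h2
  linarith [key x hx]

/-! ## Oscillation of the interpolation function -/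

theorem IsEdelsteinOn.bddAbove {J : Set ℝ} {s : ℝ → ℝ} (hs : IsEdelsteinOn J s) :
    BddAbove {r : ℝ | ∃ x ∈ J, ∃ y ∈ J, x ≠ y ∧ r = dist (s x) (s y) / dist x y} := by
  refine ⟨1, ?_⟩
  rintro r ⟨x, hx, y, hy, hxy, rfl⟩
  rw [div_le_one (dist_pos.2 hxy)]
  exact (hs.2 x hx y hy hxy).le

theorem upperLipschitz_nonneg (J : Set ℝ) (s : ℝ → ℝ) : 0 ≤ upperLipschitz J s := by
  refine Real.sSup_nonneg ?_
  rintro r ⟨x, _, y, _, _, rfl⟩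
  positivity

theorem IsEdelsteinOn.abs_sub_le {J : Set ℝ} {s : ℝ → ℝ} (hs : IsEdelsteinOn J s) {x y : ℝ}
    (hx : x ∈ J) (hy : y ∈ J) : |s x - s y| ≤ upperLipschitz J s * |x - y| := by
  rcases eq_or_ne x y with rfl | hxy
  · simp
  · rw [← Real.dist_eq, ← Real.dist_eq, ← div_le_iff₀ (dist_pos.2 hxy)]
    exact le_csSup hs.bddAbove ⟨x, hx, y, hy, hxy, rfl⟩

section FIF

variable {J : Set ℝ} {u : Plane → ℝ} {h : Fin 3 → Plane → ℝ} {s : Fin 3 → ℝ → ℝ} {f : Plane → ℝ}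

theorem IsFIF.apply_gasketMap (hf : IsFIF J u h s f) (n : Fin 3) {x : Plane}
    (hx : x ∈ sierpinskiGasket) : f (gasketMap n x) = h n x + s n (f x) := by
  have h1 : ifsMap h s n (x, f x) ∈ sierpinskiGasket.graphOn f := by
    rw [hf.invariant]
    exact mem_iUnion.2 ⟨n, mem_image_of_mem _ (mem_image_of_mem _ hx)⟩
  exact (mem_graphOn.1 h1).2

/-- Projecting the invariant graph to the plane shows that the gasket is covered by its cells. -/
theorem IsFIF.exists_gasketMap_eq (hf : IsFIF J u h s f) {x : Plane} (hx : x ∈ sierpinskiGasket) :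
    ∃ n, ∃ y ∈ sierpinskiGasket, gasketMap n y = x := by
  have h1 : (x, f x) ∈ sierpinskiGasket.graphOn f := mem_image_of_mem _ hx
  rw [hf.invariant] at h1
  obtain ⟨n, _, ⟨y, hy, rfl⟩, h2⟩ := mem_iUnion.1 h1
  exact ⟨n, y, hy, congrArg Prod.fst h2⟩

theorem IsFIF.exists_gasketWordMap_eq (hf : IsFIF J u h s f) (m : ℕ) {x : Plane}
    (hx : x ∈ sierpinskiGasket) :
    ∃ w : Fin m → Fin 3, ∃ y ∈ sierpinskiGasket, gasketWordMap m w y = x := by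
  induction m generalizing x with
  | zero => exact ⟨Fin.elim0, x, hx, rfl⟩
  | succ m ih =>
    obtain ⟨n, y, hy, rfl⟩ := hf.exists_gasketMap_eq hx
    obtain ⟨w, z, hz, rfl⟩ := ih hy
    exact ⟨Fin.cons n w, z, hz, by rw [gasketWordMap_cons]; rfl⟩

/-- The total oscillation of the interpolation function over the cells of level `m`
is `O(lam ^ m)`. -/
theorem IsFIF.exists_oscillation_sum_le (hIFS : IsNonlinearIFS J u h s) (hf : IsFIF J u h s f)
    {lam : ℝ} (h95 : 9 / 5 < lam) (hlam : ∑ n, upperLipschitz J (s n) ≤ lam) :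
    ∃ A : ℝ, 0 ≤ A ∧ ∀ m : ℕ, ∃ r : (Fin m → Fin 3) → ℝ, (∀ w, 0 ≤ r w) ∧
      (∀ w, ∀ x ∈ sierpinskiGasket, ∀ y ∈ sierpinskiGasket,
        |f (gasketWordMap m w x) - f (gasketWordMap m w y)| ≤ r w) ∧
      ∑ w, r w ≤ A * lam ^ m := by
  choose D hD0 hD using fun n => (hIFS.harmonic n).exists_oscillation_le
  -- With this `B`, `(S + B) lam^m - B (9/5)^m` solves `R_(m+1) = lam R_m + (∑ D n) (9/5)^m`, `R_0 =
  -- S` exactly.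
  set B := (∑ n, D n) / (lam - 9 / 5) with hB
  have hpos : 0 < lam - 9 / 5 := by linarith
  have hB0 : 0 ≤ B := div_nonneg (Finset.sum_nonneg fun n _ => hD0 n) hpos.le
  have hBD : ∑ n, D n = B * (lam - 9 / 5) := by rw [hB, div_mul_cancel₀ _ hpos.ne']
  set S := Metric.diam J
  have hS : 0 ≤ S := Metric.diam_nonneg
  suffices H : ∀ m : ℕ, ∃ r : (Fin m → Fin 3) → ℝ, (∀ w, 0 ≤ r w) ∧
      (∀ w, ∀ x ∈ sierpinskiGasket, ∀ y ∈ sierpinskiGasket,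
        |f (gasketWordMap m w x) - f (gasketWordMap m w y)| ≤ r w) ∧
      ∑ w, r w ≤ (S + B) * lam ^ m - B * (9 / 5) ^ m by
    refine ⟨S + B, by positivity, fun m => ?_⟩
    obtain ⟨r, h1, h2, h3⟩ := H m
    exact ⟨r, h1, h2, h3.trans (sub_le_self _ (by positivity))⟩
  intro m
  induction m with
  | zero =>
    refine ⟨fun _ => S, fun _ => hS, fun w x hx y hy => ?_, by simp⟩
    exact Metric.dist_le_diam_of_mem hIFS.isCompact.isBounded (hf.mapsTo hx) (hf.mapsTo hy)
  | succ m ih =>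
    obtain ⟨r, hr0, hr, hsum⟩ := ih
    refine ⟨fun w => (3 / 5) ^ m * D (w 0) + upperLipschitz J (s (w 0)) * r (Fin.tail w),
      fun w => add_nonneg (mul_nonneg (by positivity) (hD0 _))
        (mul_nonneg (upperLipschitz_nonneg _ _) (hr0 _)), fun w x hx y hy => ?_, ?_⟩
    · have hx' := gasketWordMap_mem_sierpinskiGasket (Fin.tail w) hx
      have hy' := gasketWordMap_mem_sierpinskiGasket (Fin.tail w) hy
      change |f (gasketMap (w 0) (gasketWordMap m (Fin.tail w) x))
        - f (gasketMap (w 0) (gasketWordMap m (Fin.tail w) y))| ≤ _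
      rw [hf.apply_gasketMap _ hx', hf.apply_gasketMap _ hy', add_sub_add_comm]
      refine (abs_add_le _ _).trans (add_le_add (hD _ _ _ _ hx _ hy) ?_)
      refine ((hIFS.edelstein (w 0)).abs_sub_le (hf.mapsTo hx') (hf.mapsTo hy')).trans ?_
      exact mul_le_mul_of_nonneg_left (hr _ _ hx _ hy) (upperLipschitz_nonneg _ _)
    · have hcard (c : ℝ) : ∑ _w : Fin m → Fin 3, (3 / 5 : ℝ) ^ m * c = c * (9 / 5) ^ m := by
        rw [← Finset.sum_mul, mul_comm]
        simp [← mul_pow]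
        norm_num
      have hr' : 0 ≤ ∑ w, r w := Finset.sum_nonneg fun w _ => hr0 w
      calc _ = ∑ n, (D n * (9 / 5) ^ m + upperLipschitz J (s n) * ∑ w, r w) := by
            rw [sum_words_succ]
            refine Finset.sum_congr rfl fun n _ => ?_
            simp only [Fin.cons_zero, Fin.tail_cons]
            rw [Finset.sum_add_distrib, hcard, ← Finset.mul_sum]
        _ = B * (lam - 9 / 5) * (9 / 5) ^ m + (∑ n, upperLipschitz J (s n)) * ∑ w, r w := by
            rw [Finset.sum_add_distrib, ← Finset.sum_mul, ← Finset.sum_mul, hBD]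
        _ ≤ B * (lam - 9 / 5) * (9 / 5) ^ m
            + lam * ((S + B) * lam ^ m - B * (9 / 5) ^ m) := by
            gcongr
        _ = _ := by rw [pow_succ, pow_succ]; ring

end FIF

/-! ## Covering the graph -/

theorem cubeCount_le_card {d : ℕ} {δ : ℝ} {F : Set (Fin d → ℝ)} (A : Finset (Fin d → ℝ))
    (hA : F ⊆ ⋃ a ∈ A, Icc a (fun i => a i + δ)) : cubeCount δ F ≤ A.card :=
  iInf₂_le A hA

/-- An interval of length `l` is covered by `⌊l / δ⌋ + 1` intervals of length `δ`. -/
theorem exists_nat_mem_Icc {δ l a y : ℝ} (hδ : 0 < δ) (hy : y ∈ Icc a (a + l)) :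
    ∃ k ∈ Finset.range (⌊l / δ⌋₊ + 1), y ∈ Icc (a + k * δ) (a + k * δ + δ) := by
  have h0 : 0 ≤ (y - a) / δ := div_nonneg (by linarith [hy.1]) hδ.le
  refine ⟨⌊(y - a) / δ⌋₊, ?_, ?_, ?_⟩
  · rw [Finset.mem_range, Nat.lt_succ_iff]
    gcongr
    linarith [hy.2]
  · have := Nat.floor_le h0
    rw [le_div_iff₀ hδ] at this
    linarith
  · have := Nat.lt_floor_add_one ((y - a) / δ)
    rw [div_lt_iff₀ hδ] at this
    linarith

/-- The graph of a function with oscillation at most `r w` on the cell of the word `w` is covered by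
`∑ w, (2 r w / δ + 1)` cubes of side length `δ ≥ 2⁻ᵐ`. -/
theorem cubeCount_graph_le {f : Plane → ℝ} {m : ℕ} {r : (Fin m → Fin 3) → ℝ}
    (hcover : ∀ x ∈ sierpinskiGasket,
      ∃ w : Fin m → Fin 3, ∃ y ∈ sierpinskiGasket, gasketWordMap m w y = x)
    (hr : ∀ w, ∀ x ∈ sierpinskiGasket, ∀ y ∈ sierpinskiGasket,
      |f (gasketWordMap m w x) - f (gasketWordMap m w y)| ≤ r w) {δ : ℝ} (hδ : 0 < δ)
    (hm : (1 / 2 : ℝ) ^ m ≤ δ) :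
    cubeCount δ (toSpace '' sierpinskiGasket.graphOn f)
      ≤ ((∑ w, (⌊2 * r w / δ⌋₊ + 1) : ℕ) : ℕ∞) := by
  classical
  let c : (Fin m → Fin 3) → ℝ := fun w => f (gasketWordMap m w (gasketVertex 0)) - r w
  -- The image of the origin is the lower left corner of a square of side `2^(-m) ≤ δ` containing
  -- the cell. The column above it has height `2 r w`, since `f` may lie `r w` below or above its
  -- value at the reference vertex.
  let A : Finset (Fin 3 → ℝ) := Finset.univ.biUnion fun w =>
    (Finset.range (⌊2 * r w / δ⌋₊ + 1)).image fun k : ℕ =>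
      toSpace (gasketWordMap m w 0, c w + k * δ)
  have hA : A.card ≤ ∑ w, (⌊2 * r w / δ⌋₊ + 1) := by
    refine Finset.card_biUnion_le.trans (Finset.sum_le_sum fun w _ => ?_)
    exact Finset.card_image_le.trans (Finset.card_range _).le
  refine (cubeCount_le_card A ?_).trans (Nat.cast_le.2 hA)
  rintro _ ⟨_, ⟨x, hx, rfl⟩, rfl⟩
  obtain ⟨w, y, hy, rfl⟩ := hcover x hx
  have hosc := abs_le.1 (hr w y hy _ (gasketVertex_mem_sierpinskiGasket 0))
  obtain ⟨k, hk, hk1, hk2⟩ := exists_nat_mem_Icc (δ := δ) (l := 2 * r w) (a := c w)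
    (y := f (gasketWordMap m w y)) hδ ⟨by simp only [c]; linarith, by simp only [c]; linarith⟩
  refine mem_iUnion₂.2 ⟨toSpace (gasketWordMap m w 0, c w + k * δ), ?_, ?_⟩
  · exact Finset.mem_biUnion.2 ⟨w, Finset.mem_univ _, Finset.mem_image_of_mem _ hk⟩
  · have hI := fullTriangle_subset_Icc (sierpinskiGasket_subset_fullTriangle hy)
    have hcoord : ∀ i, gasketWordMap m w 0 i ≤ gasketWordMap m w y i ∧
        gasketWordMap m w y i ≤ gasketWordMap m w 0 i + δ := by
      intro i
      have h0 : 0 ≤ y i := hI.1 i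
      have h1 : y i ≤ 1 := hI.2 i
      have h2 : (0 : ℝ) < (1 / 2) ^ m := by positivity
      rw [gasketWordMap_apply w y, Pi.add_apply, Pi.smul_apply, smul_eq_mul]
      constructor <;> nlinarith
    constructor <;> intro i <;> fin_cases i
    · exact (hcoord 0).1
    · exact (hcoord 1).1
    · exact hk1
    · exact (hcoord 0).2
    · exact (hcoord 1).2
    · exact hk2

/-- A power bound on the cube counts bounds the upper box-counting dimension. -/
theorem upperBoxDim_le {d : ℕ} {F : Set (Fin d → ℝ)} {C D : ℝ} (hC : 0 < C)
    (h : ∀ δ : ℝ, 0 < δ → δ < 1 → ∃ N : ℕ, cubeCount δ F ≤ N ∧ (N : ℝ) ≤ C * (1 / δ) ^ D) :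
    upperBoxDim F ≤ (D : EReal) := by
  have hlog : Tendsto (fun δ : ℝ => -Real.log δ) (𝓝[>] 0) atTop :=
    tendsto_neg_atBot_atTop.comp Real.tendsto_log_nhdsGT_zero
  have hlim : Tendsto (fun δ : ℝ => Real.log C / (-Real.log δ) + D) (𝓝[>] 0) (𝓝 D) := by
    simpa using (hlog.const_div_atTop (Real.log C)).add_const D
  have hlim' : Tendsto (fun δ : ℝ => ((Real.log C / (-Real.log δ) + D : ℝ) : EReal)) (𝓝[>] 0)
      (𝓝 (D : EReal)) := (continuous_coe_real_ereal.tendsto D).comp hlim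
  rw [upperBoxDim, ← hlim'.limsup_eq]
  refine limsup_le_limsup ?_
  filter_upwards [Ioo_mem_nhdsGT (show (0 : ℝ) < 1 by norm_num)] with δ hδ
  obtain ⟨N, hN, hNC⟩ := h δ hδ.1 hδ.2
  have hl : 0 < -Real.log δ := neg_pos.2 (Real.log_neg hδ.1 hδ.2)
  have hp : 0 < (1 / δ) ^ D := Real.rpow_pos_of_pos (one_div_pos.2 hδ.1) D
  have h1 : (cubeCount δ F : ENNReal) ≤ ENNReal.ofReal (C * (1 / δ) ^ D) := by
    refine le_trans (ENat.toENNReal_le.2 hN) ?_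
    rw [ENat.toENNReal_coe, ← ENNReal.ofReal_natCast]
    exact ENNReal.ofReal_le_ofReal hNC
  have h2 := ENNReal.log_le_log h1
  rw [ENNReal.log_ofReal_of_pos (mul_pos hC hp), Real.log_mul hC.ne' hp.ne',
    Real.log_rpow (one_div_pos.2 hδ.1), one_div, Real.log_inv] at h2
  refine (EReal.div_le_div_right_of_nonneg (EReal.coe_nonneg.2 hl.le) h2).trans ?_
  rw [← EReal.coe_div, EReal.coe_le_coe_iff, add_div, mul_div_cancel_right₀ _ hl.ne']

theorem IsFIF.upperBoxDim_le {J : Set ℝ} {u : Plane → ℝ} {h : Fin 3 → Plane → ℝ}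
    {s : Fin 3 → ℝ → ℝ} {f : Plane → ℝ} (hIFS : IsNonlinearIFS J u h s) (hf : IsFIF J u h s f)
    {lam : ℝ} (h95 : 9 / 5 < lam) (hlam : ∑ n, upperLipschitz J (s n) ≤ lam) :
    upperBoxDim (toSpace '' sierpinskiGasket.graphOn f)
      ≤ ((1 + Real.log lam / Real.log 2 : ℝ) : EReal) := by
  obtain ⟨A, hA, hosc⟩ := hf.exists_oscillation_sum_le hIFS h95 hlam
  have hlam0 : 0 < lam := by linarith
  have hl2 : 0 < Real.log 2 := Real.log_pos (by norm_num)
  set d := 1 + Real.log lam / Real.log 2 with hd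
  have hd0 : 0 ≤ d := add_nonneg zero_le_one (div_nonneg (Real.log_nonneg (by linarith)) hl2.le)
  have h2d : (2 : ℝ) ^ d = 2 * lam := by
    rw [hd, Real.rpow_add (by norm_num), Real.rpow_one, Real.rpow_def_of_pos (by norm_num),
      mul_div_cancel₀ _ hl2.ne', Real.exp_log hlam0]
  -- Level `k + 1` is used for `2^(-(k+1)) < δ ≤ 2^(-k)`; the factor `2 * lam` pays for the extra
  -- level.
  refine _root_.upperBoxDim_le (C := (2 * A + 1) * (2 * lam)) (by positivity) fun δ hδ hδ1 => ?_
  obtain ⟨k, hk1, hk2⟩ := exists_nat_pow_near_of_lt_one hδ hδ1.le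
    (show (0 : ℝ) < 1 / 2 by norm_num) (by norm_num)
  obtain ⟨r, hr0, hr, hsum⟩ := hosc (k + 1)
  refine ⟨_, cubeCount_graph_le (fun x hx => hf.exists_gasketWordMap_eq _ hx) hr hδ hk1.le, ?_⟩
  have hδk : 1 / δ ≤ 2 ^ (k + 1) := by
    rw [div_le_iff₀ hδ]
    have : (1 / 2 : ℝ) ^ (k + 1) * 2 ^ (k + 1) = 1 := by rw [← mul_pow]; norm_num
    nlinarith [show (0 : ℝ) < 2 ^ (k + 1) by positivity]
  have hkδ : (2 : ℝ) ^ k ≤ 1 / δ := by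
    rw [le_div_iff₀ hδ]
    have : (1 / 2 : ℝ) ^ k * 2 ^ k = 1 := by rw [← mul_pow]; norm_num
    nlinarith [show (0 : ℝ) < 2 ^ k by positivity]
  calc ((∑ w, (⌊2 * r w / δ⌋₊ + 1) : ℕ) : ℝ)
      ≤ ∑ w, (2 * (1 / δ) * r w + 1) := by
        push_cast
        refine Finset.sum_le_sum fun w _ => add_le_add ?_ le_rfl
        refine (Nat.floor_le (by have := hr0 w; positivity)).trans (le_of_eq ?_)
        ring
    _ = 2 * (1 / δ) * ∑ w, r w + 3 ^ (k + 1) := by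
        rw [Finset.sum_add_distrib, ← Finset.mul_sum]
        simp
    -- The `3^(k+1)` cells are absorbed because `3 < 18/5 < 2 * lam`.
    _ ≤ 2 * 2 ^ (k + 1) * (A * lam ^ (k + 1)) + (2 * lam) ^ (k + 1) := by
        have := Finset.sum_nonneg fun w (_ : w ∈ Finset.univ) => hr0 w
        gcongr
        linarith
    _ = (2 * A + 1) * (2 * lam) * ((2 * lam) ^ k) := by
        rw [pow_succ (2 * lam), mul_pow, pow_succ 2, pow_succ lam]; ring
    _ = (2 * A + 1) * (2 * lam) * ((2 : ℝ) ^ k) ^ d := by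
        rw [← h2d, ← Real.rpow_natCast, ← Real.rpow_natCast, ← Real.rpow_mul (by norm_num),
          ← Real.rpow_mul (by norm_num), mul_comm d]
    _ ≤ _ := by gcongr

theorem theorem4p1 (J : Set ℝ) (u : Plane → ℝ) (h : Fin 3 → Plane → ℝ) (s : Fin 3 → ℝ → ℝ)
    (hIFS : IsNonlinearIFS J u h s)
    (hu : ¬ Coplanar ℝ (toSpace '' (gasketVertices 1).graphOn u))
    (f : Plane → ℝ) (hf : IsFIF J u h s f)
    (μ : ℝ) (hμ : μ = ∑ n, upperLipschitz J (s n)) :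
    (9 / 5 < μ →
      upperBoxDim (toSpace '' sierpinskiGasket.graphOn f)
        ≤ ((1 + Real.log μ / Real.log 2 : ℝ) : EReal)) ∧
    (μ ≤ 9 / 5 →
      upperBoxDim (toSpace '' sierpinskiGasket.graphOn f)
        ≤ ((Real.log (18 / 5) / Real.log 2 : ℝ) : EReal)) := by
  refine ⟨fun h95 => hf.upperBoxDim_le hIFS h95 hμ.ge, fun h95 => ?_⟩
  have hl2 : Real.log 2 ≠ 0 := (Real.log_pos (by norm_num)).ne'
  have he : Real.log (18 / 5) / Real.log 2 = 1 + Real.log (9 / 5) / Real.log 2 := by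
    rw [show (18 / 5 : ℝ) = 2 * (9 / 5) by norm_num, Real.log_mul (by norm_num) (by norm_num),
      add_div, div_self hl2]
  have hc : ContinuousAt (fun x : ℝ => 1 + Real.log x / Real.log 2) (9 / 5) :=
    continuousAt_const.add ((Real.continuousAt_log (by norm_num)).div_const _)
  rw [he]
  -- The value `lam = 9/5` itself is excluded, as `B` would blow up; the bounds for `lam > 9/5` pass
  -- to the limit.
  have ht : Tendsto (fun x : ℝ => ((1 + Real.log x / Real.log 2 : ℝ) : EReal)) (𝓝[>] (9 / 5))
      (𝓝 ((1 + Real.log (9 / 5) / Real.log 2 : ℝ) : EReal)) :=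
    (continuous_coe_real_ereal.continuousAt.comp hc).tendsto.mono_left nhdsWithin_le_nhds
  refine ge_of_tendsto ht ?_
  filter_upwards [self_mem_nhdsWithin] with lam hlam
  exact hf.upperBoxDim_le hIFS hlam (hμ ▸ h95.trans (le_of_lt hlam))
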